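/- Let $(X_n)_{n\ge 0}$ be an irreducible, positive recurrent (not necessarily reversible) time-homogeneous Markov chain on a countable discrete state space $M$, and write $\mathbb P_x,\mathbb E_x$ for the chain started at $x$. Let $T(x)=\inf\{n\ge 0 : X_n=x\}$, and for $A\subset M$ let $$T_{\mathrm{cov}}(A)=\sup_{x\in A}T(x),\qquad \mathrm{cov}(A)=\sup_{z\in A}\mathbb E_z T_{\mathrm{cov}}(A),\qquad d(x,y)=\mathbb E_xT(y)+\mathbb E_yT(x),$$ so that $d$ is the commute-time distance. Let $N_0=1$ and $N_n=2^{2^n}$ for $n\ge 1$. A sequence $(\mathcal A_n)_{n\ge 0}$ of partitions of $A$ is called admissible if $\mathcal A_{n+1}$ is a refinement of $\mathcal A_n$ and $|\mathcal A_n|\le N_n$ for every $n\ge 0$. Let $A_n(x)$ be the element of $\mathcal A_n$ containing $x$, let $\Delta(B,\rho)$ be the diameter of $B$ with respect to a distance $\rho$, write $\Delta(B)=\Delta(B,d)$, and set $$\gamma_2(A,\rho)=\inf_{(\mathcal A_n)\ \mathrm{admissible}}\ \sup_{x\in A}\ \sum_{n=0}^{\infty}2^{n/2}\,\Delta(A_n(x),\rho).$$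 Suprema over the empty set are $0$, and all quantities take values in $[0,+\infty]$. Then for every subset $A\subset M$, finite or infinite (in particular for $A=M$), the following hold with the universal constant $L=40$. (i) For every $z\in A$ and every admissible sequence $(\mathcal A_n)_{n\ge 0}$ of partitions of $A$, $$\mathbb E_z T_{\mathrm{cov}}(A)\ \le\ L\,\Bigl(\sup_{x\in A}\sum_{n=0}^{\infty}2^{n/2}\sqrt{\Delta(A_n(x))}\Bigr)^2 .$$ (ii) $\mathrm{cov}(A)\ \le\ L\,\bigl[\gamma_2(A,\sqrt d)\bigr]^2 .$ -/

import Mathlib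

open MeasureTheory ProbabilityTheory
open scoped ENNReal

noncomputable section

namespace CoverTime

section Chain

variable {M : Type*} [MeasurableSpace M]

/-- The law `ℙ_x`, on the path space `ℕ → M`, of the time-homogeneous Markov chain `(X_n)` with
transition kernel `P` started at `x`. The chain itself is the coordinate process `X_n ω = ω n`. -/
def chainLaw (P : Kernel M M) [IsMarkovKernel P] (x : M) : Measure (ℕ → M) :=
  Kernel.trajMeasure (X := fun _ : ℕ => M) (Measure.dirac x)
    (fun n => P.comap (fun h : (i : Finset.Iic n) → M => h ⟨n, Finset.mem_Iic.2 le_rfl⟩)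
      (measurable_pi_apply _))

/-- `T(x) = inf {n ≥ 0 : X_n = x}`, with value `⊤` if `x` is never visited. -/
def hitTime (x : M) (ω : ℕ → M) : ℕ∞ :=
  hittingAfter (fun (n : ℕ) (ω : ℕ → M) => ω n) {x} 0 ω

/-- `T¹(x) = inf {n ≥ 1 : X_n = x}`, with value `⊤` if there is no such `n`. -/
def returnTime (x : M) (ω : ℕ → M) : ℕ∞ :=
  hittingAfter (fun (n : ℕ) (ω : ℕ → M) => ω n) {x} 1 ω

/-- `T_cov(A) = sup_{x ∈ A} T(x)`. -/
def coverTime (A : Set M) (ω : ℕ → M) : ℕ∞ :=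
  ⨆ x ∈ A, hitTime x ω

/-- Every state is positive recurrent: `𝔼_x T¹(x) < ∞` for every `x`. -/
def PositiveRecurrent (P : Kernel M M) [IsMarkovKernel P] : Prop :=
  ∀ x, ∫⁻ ω, (returnTime x ω : ℝ≥0∞) ∂(chainLaw P x) < ∞

/-- `𝔼_z T_cov(A)`. -/
def expectedCoverTime (P : Kernel M M) [IsMarkovKernel P] (z : M) (A : Set M) : ℝ≥0∞ :=
  ∫⁻ ω, (coverTime A ω : ℝ≥0∞) ∂(chainLaw P z)

/-- `cov(A) = sup_{z ∈ A} 𝔼_z T_cov(A)`. -/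
def cov (P : Kernel M M) [IsMarkovKernel P] (A : Set M) : ℝ≥0∞ :=
  ⨆ z ∈ A, expectedCoverTime P z A

/-- The commute-time distance `d(x,y) = 𝔼_x T(y) + 𝔼_y T(x)`. -/
def commuteDist (P : Kernel M M) [IsMarkovKernel P] (x y : M) : ℝ≥0∞ :=
  ∫⁻ ω, (hitTime y ω : ℝ≥0∞) ∂(chainLaw P x) + ∫⁻ ω, (hitTime x ω : ℝ≥0∞) ∂(chainLaw P y)

end Chain

section Chaining

variable {M : Type*}

/-- `N_0 = 1` and `N_n = 2^(2^n)` for `n ≥ 1`. -/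
def chainCard (n : ℕ) : ℕ :=
  if n = 0 then 1 else 2 ^ (2 ^ n)

/-- A sequence of partitions of `A` is admissible if each partition refines the previous one
and the `n`-th partition has at most `N_n` elements. -/
structure IsAdmissible {A : Set M} (𝒜 : ℕ → Partition A) : Prop where
  refines : ∀ n, 𝒜 (n + 1) ≤ 𝒜 n
  encard_le : ∀ n, {B : Set M | B ∈ 𝒜 n}.encard ≤ (chainCard n : ℕ∞)

/-- The diameter of `B` with respect to `d`. -/
def diam (d : M → M → ℝ≥0∞) (B : Set M) : ℝ≥0∞ :=
  ⨆ x ∈ B, ⨆ y ∈ B, d x y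

/-- `γ₂(A, d)`: the infimum over all admissible sequences of partitions of `A` of
`sup_{x ∈ A} ∑_n 2^(n/2) Δ(A_n(x), d)`. Here `(𝒜 n).partOf x` is `A_n(x)`, the element of
`𝒜 n` that contains `x`. -/
def gamma2 (A : Set M) (d : M → M → ℝ≥0∞) : ℝ≥0∞ :=
  ⨅ (𝒜 : ℕ → Partition A) (_ : IsAdmissible 𝒜),
    ⨆ x ∈ A, ∑' n : ℕ, (2 : ℝ≥0∞) ^ ((n : ℝ) / 2) * diam d ((𝒜 n).partOf x)

end Chaining

end CoverTime

end

set_option linter.unusedSectionVars false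

/-! Chain through local times. Weight each visit to `x` by the mean return time `R(x)`. Two points
at small commute distance `d` then accumulate nearly equal local time: if `x` has local time about
`u²`, then `y` still has at most `v² ≤ u²` with probability at most `exp(1 - (u - v)²/d)`
(`chainLaw_lagging_floor_le`). So square roots of local times have subgaussian increments for `√d`,
which is what `γ₂` controls.

Suppose that at visit number `j` to `z` some `x ∈ A` is unvisited. Follow representatives of
`A_n(x)` from `z` to `x`, and let the required square root of local time fall from `u = √(j R(z))`
by `u 2^(n/2) √Δ(A_n(x)) / B` at level `n`. If `B` exceeds the chaining functional `S`, all the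
levels stay positive. Since `z` meets its requirement and `x` does not, some link fails. A link at
level `n` fails with probability at most `exp(1 - 2^n u²/B²)`, and only `N_(n+1)` different links
occur there. The union bound gives `17 exp(-j R(z)/B²)` (`chainLaw_notCoveredAtVisit_le`).

The mean cover time is at most `R(z)` times the mean number of visits to `z` before covering
(`expectedCoverTime_le`). Summing over `j` gives `17 (R(z) + B²)`, and `R(z) ≤ d(z,y) ≤ S²` for any
other `y ∈ A`. Reversibility is never needed: the commute distance enters only through identities
for mean hitting times. -/

namespace CoverTime

/-! ### First-step decomposition of the path law. -/

section Markov

variable {M : Type*} [MeasurableSpace M]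

/-- The path that starts at `w` and continues as `ω`. -/
def cons (w : M) (ω : ℕ → M) : ℕ → M
  | 0 => w
  | n + 1 => ω n

@[simp] lemma cons_zero (w : M) (ω : ℕ → M) : cons w ω 0 = w := rfl

@[simp] lemma cons_succ (w : M) (ω : ℕ → M) (n : ℕ) : cons w ω (n + 1) = ω n := rfl

lemma measurable_cons (w : M) : Measurable (cons w) := by
  refine measurable_pi_iff.2 fun n => ?_
  cases n with
  | zero => exact measurable_const
  | succ n => exact measurable_pi_apply n

instance (P : Kernel M M) [IsMarkovKernel P] (x : M) : IsProbabilityMeasure (chainLaw P x) := by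
  unfold chainLaw; infer_instance

variable [Countable M] [MeasurableSingletonClass M]

/-- The set of paths that agree with `a` up to time `n`. -/
def prefixSet (a : ℕ → M) (n : ℕ) : Set (ℕ → M) := {ω | ∀ i ≤ n, ω i = a i}

lemma prefixSet_eq_preimage (a : ℕ → M) (n : ℕ) :
    prefixSet a n = Preorder.frestrictLe (π := fun _ : ℕ => M) n ⁻¹'
      {Preorder.frestrictLe (π := fun _ : ℕ => M) n a} := by
  ext ω
  simp [prefixSet, funext_iff]

lemma measurableSet_prefixSet (a : ℕ → M) (n : ℕ) : MeasurableSet (prefixSet a n) := by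
  rw [prefixSet_eq_preimage]
  exact Preorder.measurable_frestrictLe n (measurableSet_singleton _)

lemma chainLaw_prefixSet_zero (P : Kernel M M) [IsMarkovKernel P] (x : M) (a : ℕ → M) :
    chainLaw P x (prefixSet a 0) = Set.indicator {a 0} 1 x := by
  rw [prefixSet_eq_preimage, ← Measure.map_apply (by fun_prop) (measurableSet_singleton _)]
  unfold chainLaw Kernel.trajMeasure
  rw [Measure.map_comp _ _ (by fun_prop), Kernel.traj_map_frestrictLe, Kernel.partialTraj_self,
    Measure.id_comp, Measure.map_apply (by fun_prop) (measurableSet_singleton _),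
    Measure.dirac_apply' _ (by measurability)]
  have : ((MeasurableEquiv.piUnique fun _ : Finset.Iic 0 => M).symm ⁻¹'
      {Preorder.frestrictLe (π := fun _ : ℕ => M) 0 a}) = {a 0} := by
    ext v
    simp only [Set.mem_preimage, Set.mem_singleton_iff]
    rw [MeasurableEquiv.symm_apply_eq]
    rfl
  rw [← this]

lemma chainLaw_prefixSet_succ (P : Kernel M M) [IsMarkovKernel P] (x : M) (a : ℕ → M) (n : ℕ) :
    chainLaw P x (prefixSet a (n + 1)) = chainLaw P x (prefixSet a n) * P (a n) {a (n + 1)} := by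
  have key := Kernel.map_frestrictLe_trajMeasure_compProd_eq_map_trajMeasure (X := fun _ : ℕ => M)
    (μ₀ := Measure.dirac x)
    (κ := fun n => P.comap (fun h : (i : Finset.Iic n) → M => h ⟨n, Finset.mem_Iic.2 le_rfl⟩)
      (measurable_pi_apply _)) (a := n)
  have key2 := congrArg (fun μ => μ ({Preorder.frestrictLe (π := fun _ : ℕ => M) n a} ×ˢ
    {a (n + 1)})) key
  change _ = Measure.map _ (chainLaw P x) _ at key2
  rw [Measure.map_apply (by fun_prop) (by measurability)] at key2
  have h1 : prefixSet a (n + 1) = (fun ω : ℕ → M => (Preorder.frestrictLe (π := fun _ : ℕ => M) n ω,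
      ω (n + 1))) ⁻¹' ({Preorder.frestrictLe (π := fun _ : ℕ => M) n a} ×ˢ {a (n + 1)}) := by
    ext ω
    simp only [prefixSet, Set.mem_ofPred_eq, Set.mem_preimage, Set.mem_prod, Set.mem_singleton_iff,
      funext_iff, Preorder.frestrictLe_apply, Subtype.forall, Finset.mem_Iic]
    constructor
    · exact fun h => ⟨fun i hi => h i (by omega), h _ le_rfl⟩
    · rintro ⟨h, h'⟩ i hi
      rcases Nat.lt_or_ge n i with h2 | h2
      · obtain rfl : i = n + 1 := by omega
        exact h'
      · exact h i h2
  rw [h1, ← key2, Measure.compProd_apply_prod (by measurability) (by measurability)]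
  rw [prefixSet_eq_preimage]
  rw [lintegral_singleton, mul_comm, Measure.map_apply (by fun_prop) (by measurability)]
  rfl

/-- Initial segments range over a countable type, so masses of single segments determine every
finite-dimensional law, and cylinders form a generating π-system. -/
lemma measure_eq_of_prefixSet {μ ν : Measure (ℕ → M)} [IsProbabilityMeasure μ]
    [IsProbabilityMeasure ν] [Nonempty M]
    (h : ∀ a n, μ (prefixSet a n) = ν (prefixSet a n)) : μ = ν := by
  have hmap (n : ℕ) : μ.map (Preorder.frestrictLe (π := fun _ : ℕ => M) n) =
      ν.map (Preorder.frestrictLe (π := fun _ : ℕ => M) n) := by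
    refine Measure.ext_of_singleton fun b => ?_
    rw [Measure.map_apply (by fun_prop) (measurableSet_singleton _),
      Measure.map_apply (by fun_prop) (measurableSet_singleton _)]
    obtain ⟨c⟩ := ‹Nonempty M›
    have hb : b = Preorder.frestrictLe (π := fun _ : ℕ => M) n
        (fun i => if hi : i ∈ Finset.Iic n then b ⟨i, hi⟩ else c) := by
      ext i
      simp [Finset.mem_Iic.1 i.2]
    rw [hb, ← prefixSet_eq_preimage]
    exact h _ _
  refine ext_of_generate_finite (measurableCylinders fun _ : ℕ => M)
    generateFrom_measurableCylinders.symm isPiSystem_measurableCylinders ?_ (by simp)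
  intro s hs
  obtain ⟨N, S, mS, rfl⟩ : ∃ N S, MeasurableSet S ∧ s = cylinder (Finset.Iic N) S := by
    simpa [measurableCylinders_nat] using hs
  have h1 := congrArg (fun μ => μ S) (hmap N)
  simp only at h1
  rwa [Measure.map_apply (by fun_prop) mS, Measure.map_apply (by fun_prop) mS] at h1

/-- Both sides give the same mass to each initial segment. This Markov property at time 1 replaces
the strong Markov property: later path estimates are inductions on a time horizon. -/
lemma chainLaw_apply (P : Kernel M M) [IsMarkovKernel P] (w : M) {E : Set (ℕ → M)}
    (hE : MeasurableSet E) :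
    chainLaw P w E = ∫⁻ v, chainLaw P v (cons w ⁻¹' E) ∂(P w) := by
  have : Nonempty M := ⟨w⟩
  let ν : Measure (ℕ → M) := (P w).bind fun v => (chainLaw P v).map (cons w)
  have hν {E : Set (ℕ → M)} (hE : MeasurableSet E) :
      ν E = ∫⁻ v, chainLaw P v (cons w ⁻¹' E) ∂(P w) := by
    rw [Measure.bind_apply hE Measurable.of_discrete.aemeasurable]
    exact lintegral_congr fun v => Measure.map_apply (measurable_cons w) hE
  have : IsProbabilityMeasure ν := ⟨by rw [hν MeasurableSet.univ]; simp⟩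
  rw [← hν hE]
  congr 1
  refine measure_eq_of_prefixSet fun a n => ?_
  induction n with
  | zero =>
    rw [hν (measurableSet_prefixSet a 0), chainLaw_prefixSet_zero]
    by_cases hw : w = a 0
    · simp [prefixSet, hw]
    · simp [prefixSet, hw]
  | succ n ih =>
    rw [chainLaw_prefixSet_succ, ih, hν (measurableSet_prefixSet a _),
      hν (measurableSet_prefixSet a _)]
    by_cases hw : w = a 0
    swap
    · have hz (m : ℕ) : cons w ⁻¹' prefixSet a m = ∅ := by
        ext ω
        simp only [prefixSet, Set.mem_preimage, Set.mem_ofPred_eq, Set.mem_empty_iff_false, iff_false]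
        exact fun h => hw (h 0 (by omega))
      simp [hz]
    subst hw
    have hpre (m : ℕ) : cons (a 0) ⁻¹' prefixSet a (m + 1) =
        prefixSet (fun i => a (i + 1)) m := by
      ext ω
      simp only [prefixSet, Set.mem_preimage, Set.mem_ofPred_eq]
      constructor
      · exact fun h i hi => h (i + 1) (by omega)
      · intro h i hi
        cases i with
        | zero => rfl
        | succ i => exact h i (by omega)
    cases n with
    | zero =>
      have h0 : cons (a 0) ⁻¹' prefixSet a 0 = Set.univ := by
        ext ω; simp [prefixSet]
      simp_rw [hpre, chainLaw_prefixSet_zero]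
      rw [h0, lintegral_indicator_one (measurableSet_singleton _)]
      simp
    | succ n =>
      simp_rw [hpre]
      rw [← lintegral_mul_const _ Measurable.of_discrete]
      exact lintegral_congr fun v =>
        (chainLaw_prefixSet_succ P v (fun i => a (i + 1)) n).symm

end Markov

end CoverTime

/-! ### Hitting and return times: tail sums, first-step equations, finiteness. -/

namespace CoverTime

lemma enat_toENNReal_eq_tsum (t : ℕ∞) :
    (t : ℝ≥0∞) = ∑' n : ℕ, Set.indicator {n : ℕ | (n : ℕ∞) < t} (fun _ => 1) n := by
  rw [← tsum_subtype, ENNReal.tsum_const, mul_one]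
  congr 1
  induction t using ENat.recTopCoe with
  | top =>
    have : {n : ℕ | (n : ℕ∞) < ⊤} = Set.univ := by ext; simp
    rw [this]
    simp
  | coe m =>
    have : {n : ℕ | (n : ℕ∞) < (m : ℕ∞)} = (Finset.range m : Set ℕ) := by ext; simp
    rw [this]
    simp

lemma lintegral_enat_eq_tsum {Ω : Type*} [MeasurableSpace Ω] (μ : Measure Ω) {f : Ω → ℕ∞}
    (hf : ∀ n : ℕ, MeasurableSet {ω | (n : ℕ∞) < f ω}) :
    ∫⁻ ω, (f ω : ℝ≥0∞) ∂μ = ∑' n : ℕ, μ {ω | (n : ℕ∞) < f ω} := by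
  simp_rw [enat_toENNReal_eq_tsum]
  have h (n : ℕ) (ω : Ω) : Set.indicator {n : ℕ | (n : ℕ∞) < f ω} (fun _ => (1 : ℝ≥0∞)) n =
      Set.indicator {ω | (n : ℕ∞) < f ω} 1 ω := rfl
  simp_rw [h]
  rw [lintegral_tsum fun n => (measurable_one.indicator (hf n)).aemeasurable]
  exact tsum_congr fun n => lintegral_indicator_one (hf n)

section Times

variable {M : Type*}

lemma lt_hitTime_iff (x : M) (ω : ℕ → M) (n : ℕ) :
    (n : ℕ∞) < hitTime x ω ↔ ∀ t ≤ n, ω t ≠ x := by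
  constructor
  · intro h t ht
    exact notMem_of_lt_hittingAfter (u := fun (n : ℕ) (ω : ℕ → M) => ω n) (s := {x}) (n := 0)
      (lt_of_le_of_lt (Nat.cast_le.2 ht) h) (Nat.zero_le t)
  · intro h
    classical
    unfold hitTime hittingAfter
    split_ifs with hex
    · have hm := Nat.sInf_mem (s := {i | 0 ≤ i ∧ ω i ∈ ({x} : Set M)}) hex
      refine Nat.cast_lt.2 ?_
      by_contra hle
      exact h _ (not_lt.1 hle) hm.2
    · exact WithTop.coe_lt_top n

lemma lt_returnTime_iff (x : M) (ω : ℕ → M) (n : ℕ) :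
    (n : ℕ∞) < returnTime x ω ↔ ∀ t, 1 ≤ t → t ≤ n → ω t ≠ x := by
  constructor
  · intro h t ht1 ht
    exact notMem_of_lt_hittingAfter (u := fun (n : ℕ) (ω : ℕ → M) => ω n) (s := {x}) (n := 1)
      (lt_of_le_of_lt (Nat.cast_le.2 ht) h) ht1
  · intro h
    classical
    unfold returnTime hittingAfter
    split_ifs with hex
    · have hm := Nat.sInf_mem (s := {i | 1 ≤ i ∧ ω i ∈ ({x} : Set M)}) hex
      refine Nat.cast_lt.2 ?_
      by_contra hle
      exact h _ hm.1 (not_lt.1 hle) hm.2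
    · exact WithTop.coe_lt_top n

/-- The set of paths that have not visited all of `A` by time `n`. -/
def notCovered (A : Set M) (n : ℕ) : Set (ℕ → M) := {ω | ∃ x ∈ A, ∀ t ≤ n, ω t ≠ x}

lemma lt_coverTime_iff (A : Set M) (ω : ℕ → M) (n : ℕ) :
    (n : ℕ∞) < coverTime A ω ↔ ω ∈ notCovered A n := by
  simp [coverTime, lt_iSup_iff, lt_hitTime_iff, notCovered]

lemma coverTime_singleton (x : M) (ω : ℕ → M) : coverTime {x} ω = hitTime x ω := by
  simp [coverTime]

lemma cons_preimage_notCovered_zero (w : M) (A : Set M) :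
    cons w ⁻¹' notCovered A 0 = {_ω | (A \ {w}).Nonempty} := by
  ext ω
  simp [notCovered, Set.Nonempty, eq_comm]

/-- The first state leaves the set still to be covered, so inductions on time must let `A` vary. -/
lemma cons_preimage_notCovered_succ (w : M) (A : Set M) (n : ℕ) :
    cons w ⁻¹' notCovered A (n + 1) = notCovered (A \ {w}) n := by
  ext ω
  simp only [notCovered, Set.mem_preimage, Set.mem_ofPred_eq, Set.mem_sdiff, Set.mem_singleton_iff]
  constructor
  · rintro ⟨x, hx, h⟩
    exact ⟨x, ⟨hx, fun e => h 0 (by omega) e.symm⟩, fun t ht => h (t + 1) (by omega)⟩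
  · rintro ⟨x, ⟨hx, hxw⟩, h⟩
    refine ⟨x, hx, fun t ht => ?_⟩
    cases t with
    | zero => exact fun e => hxw e.symm
    | succ t => exact h t (by omega)

lemma notCovered_empty (n : ℕ) : notCovered (∅ : Set M) n = ∅ := by simp [notCovered]

variable [MeasurableSpace M] [Countable M] [MeasurableSingletonClass M]

lemma measurableSet_eval (t : ℕ) (S : Set M) : MeasurableSet {ω : ℕ → M | ω t ∈ S} :=
  measurable_pi_apply t (Set.to_countable S).measurableSet

lemma measurableSet_notCovered (A : Set M) (n : ℕ) : MeasurableSet (notCovered A n) := by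
  have : notCovered A n = ⋃ x ∈ A, ⋂ t ∈ Set.Iic n, {ω : ℕ → M | ω t ∈ ({x}ᶜ : Set M)} := by
    ext; simp [notCovered]
  rw [this]
  exact MeasurableSet.biUnion (Set.to_countable A) fun x _ =>
    MeasurableSet.biInter (Set.to_countable _) fun t _ => measurableSet_eval t _

variable (P : Kernel M M) [IsMarkovKernel P]

lemma expectedCoverTime_eq_tsum (z : M) (A : Set M) :
    expectedCoverTime P z A = ∑' n, chainLaw P z (notCovered A n) := by
  unfold expectedCoverTime
  have h (n : ℕ) : {ω : ℕ → M | (n : ℕ∞) < coverTime A ω} = notCovered A n :=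
    Set.ext fun ω => lt_coverTime_iff A ω n
  rw [lintegral_enat_eq_tsum _ fun n => by rw [h]; exact measurableSet_notCovered A n]
  simp_rw [h]

lemma chainLaw_notCovered_zero (w : M) (A : Set M) [Decidable (A \ {w}).Nonempty] :
    chainLaw P w (notCovered A 0) = if (A \ {w}).Nonempty then 1 else 0 := by
  rw [chainLaw_apply P w (measurableSet_notCovered A 0), cons_preimage_notCovered_zero]
  split_ifs with h <;> simp [h]

lemma chainLaw_notCovered_succ (w : M) (A : Set M) (n : ℕ) :
    chainLaw P w (notCovered A (n + 1)) = ∫⁻ v, chainLaw P v (notCovered (A \ {w}) n) ∂(P w) := by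
  rw [chainLaw_apply P w (measurableSet_notCovered A _), cons_preimage_notCovered_succ]

/-- `𝔼_w T(x)`. -/
noncomputable def hitMean (w x : M) : ℝ≥0∞ := ∫⁻ ω, (hitTime x ω : ℝ≥0∞) ∂(chainLaw P w)

/-- `𝔼_x T¹(x)`. -/
noncomputable def returnMean (x : M) : ℝ≥0∞ := ∫⁻ ω, (returnTime x ω : ℝ≥0∞) ∂(chainLaw P x)

lemma commuteDist_eq (x y : M) : commuteDist P x y = hitMean P x y + hitMean P y x := rfl

lemma hitMean_eq_tsum (w x : M) : hitMean P w x = ∑' n, chainLaw P w (notCovered {x} n) := by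
  rw [← expectedCoverTime_eq_tsum]
  simp [hitMean, expectedCoverTime, coverTime_singleton]

lemma hitMean_self (x : M) : hitMean P x x = 0 := by
  classical
  rw [hitMean_eq_tsum, ENNReal.tsum_eq_zero]
  intro n
  cases n with
  | zero => simp [chainLaw_notCovered_zero]
  | succ n => simp [chainLaw_notCovered_succ, notCovered_empty]

lemma lintegral_hitMean (w x : M) :
    ∫⁻ v, hitMean P v x ∂(P w) = ∑' n, ∫⁻ v, chainLaw P v (notCovered {x} n) ∂(P w) := by
  simp_rw [hitMean_eq_tsum]
  exact lintegral_tsum fun n => Measurable.of_discrete.aemeasurable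

lemma hitMean_of_ne {w x : M} (h : w ≠ x) :
    hitMean P w x = 1 + ∫⁻ v, hitMean P v x ∂(P w) := by
  classical
  have h1 : ({x} : Set M) \ {w} = {x} := by simp [h]
  rw [lintegral_hitMean, hitMean_eq_tsum, tsum_eq_zero_add' ENNReal.summable,
    chainLaw_notCovered_zero]
  simp [chainLaw_notCovered_succ, h1]

lemma returnMean_eq (x : M) : returnMean P x = 1 + ∫⁻ v, hitMean P v x ∂(P x) := by
  have hm (n : ℕ) : MeasurableSet {ω : ℕ → M | (n : ℕ∞) < returnTime x ω} := by
    have : {ω : ℕ → M | (n : ℕ∞) < returnTime x ω} =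
        ⋂ t ∈ Set.Icc 1 n, {ω : ℕ → M | ω t ∈ ({x}ᶜ : Set M)} := by
      ext; simp [lt_returnTime_iff]
    rw [this]
    exact MeasurableSet.biInter (Set.to_countable _) fun t _ => measurableSet_eval t _
  unfold returnMean
  rw [lintegral_enat_eq_tsum _ hm, tsum_eq_zero_add' ENNReal.summable, lintegral_hitMean]
  congr 1
  · have : {ω : ℕ → M | ((0 : ℕ) : ℕ∞) < returnTime x ω} = Set.univ := by
      ext ω; simp only [lt_returnTime_iff, Set.mem_ofPred_eq, Set.mem_univ, iff_true]; omega
    rw [this, measure_univ]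
  · refine tsum_congr fun n => ?_
    rw [chainLaw_apply P x (hm _)]
    refine lintegral_congr fun v => ?_
    congr 1
    ext ω
    simp only [Set.mem_preimage, Set.mem_ofPred_eq, lt_returnTime_iff, notCovered,
      Set.mem_singleton_iff, exists_eq_left]
    constructor
    · exact fun h t ht => h (t + 1) (by omega) (by omega)
    · intro h t ht1 ht
      obtain ⟨s, rfl⟩ := Nat.exists_eq_add_of_le' ht1
      exact h s (by omega)

/-- The expected hitting time is the least function satisfying the one-step inequality. -/
lemma hitMean_le_of_supersolution (x : M) (g : M → ℝ≥0∞)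
    (hg : ∀ w, w ≠ x → 1 + ∫⁻ v, g v ∂(P w) ≤ g w) (w : M) : hitMean P w x ≤ g w := by
  classical
  -- Bounding truncated means by induction avoids any finiteness assumption on `g`.
  rw [hitMean_eq_tsum, ENNReal.tsum_eq_iSup_nat]
  refine iSup_le fun n => ?_
  induction n generalizing w with
  | zero => simp
  | succ n ih =>
    by_cases h : w = x
    · subst h
      have h0 : ∑' n, chainLaw P w (notCovered {w} n) = 0 := by
        rw [← hitMean_eq_tsum, hitMean_self]
      rw [ENNReal.tsum_eq_zero] at h0
      simp [h0]
    · have h1 : ({x} : Set M) \ {w} = {x} := by simp [h]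
      rw [Finset.sum_range_succ', chainLaw_notCovered_zero, add_comm]
      simp only [chainLaw_notCovered_succ, h1, Set.singleton_nonempty, if_true]
      rw [← lintegral_finsetSum _ fun i _ => Measurable.of_discrete]
      exact le_trans (by gcongr with v; exact ih v) (hg w h)

lemma hitMean_triangle (w x y : M) : hitMean P w y ≤ hitMean P w x + hitMean P x y := by
  -- The sum alone can fail to be a supersolution at `w = x`, where `hitMean P w x` vanishes; there
  -- the other branch of the minimum takes over.
  let g : M → ℝ≥0∞ := fun w => min (hitMean P w x + hitMean P x y) (hitMean P w y)
  refine le_trans (hitMean_le_of_supersolution P y g (fun w hw => le_min ?_ ?_) w)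
    (min_le_left _ _)
  · by_cases hx : w = x
    · subst hx
      rw [hitMean_self, zero_add, hitMean_of_ne P hw]
      gcongr with v
      exact min_le_right _ _
    · rw [hitMean_of_ne P hx]
      calc 1 + ∫⁻ v, g v ∂(P w) ≤ 1 + ∫⁻ v, (hitMean P v x + hitMean P x y) ∂(P w) := by
            gcongr with v; exact min_le_left _ _
        _ = _ := by
            rw [lintegral_add_right _ measurable_const]
            simp [add_assoc]
  · rw [hitMean_of_ne P hw]
    gcongr with v
    exact min_le_right _ _

lemma one_le_hitMean {w x : M} (h : w ≠ x) : 1 ≤ hitMean P w x := by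
  rw [hitMean_of_ne P h]; exact le_self_add

lemma one_le_returnMean (x : M) : 1 ≤ returnMean P x := by
  rw [returnMean_eq]; exact le_self_add

lemma returnMean_le_commuteDist {x y : M} (h : x ≠ y) : returnMean P x ≤ commuteDist P x y := by
  rw [returnMean_eq, commuteDist_eq, hitMean_of_ne P h, add_assoc]
  gcongr
  calc ∫⁻ v, hitMean P v x ∂(P x) ≤ ∫⁻ v, (hitMean P v y + hitMean P y x) ∂(P x) := by
        gcongr with v; exact hitMean_triangle P v y x
    _ = _ := by rw [lintegral_add_right _ measurable_const]; simp

/-- By the first-step equations, a state with finite mean hitting time of `x` almost surely moves to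
another such state; positive recurrence covers the step out of `x` itself. Hence from `x` the chain
never enters the set of infinite mean, while irreducibility reaches every `w`. -/
lemma hitMean_lt_top (hirr : Kernel.IsIrreducible Measure.count P) (hpos : PositiveRecurrent P)
    (w x : M) : hitMean P w x < ∞ := by
  have hint (v : M) (hv : hitMean P v x < ∞) : ∫⁻ u, hitMean P u x ∂(P v) < ∞ := by
    by_cases h : v = x
    · subst h
      have := hpos v
      change returnMean P v < ∞ at this
      rw [returnMean_eq] at this
      exact lt_of_le_of_lt le_add_self this
    · rw [hitMean_of_ne P h] at hv
      exact lt_of_le_of_lt le_add_self hv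
  have hpow (n : ℕ) (v : M) (hv : hitMean P v x < ∞) : (P ^ n) v {u | hitMean P u x = ∞} = 0 := by
    induction n generalizing v with
    | zero =>
      rw [pow_zero, show (1 : Kernel M M) = Kernel.id from rfl, Kernel.id_apply,
        Measure.dirac_apply' _ (Set.to_countable _).measurableSet]
      simp [hv.ne]
    | succ n ih =>
      rw [add_comm, Kernel.pow_add_apply_eq_lintegral _ _ _ _ (Set.to_countable _).measurableSet,
        pow_one]
      rw [lintegral_eq_zero_iff Measurable.of_discrete]
      filter_upwards [ae_lt_top Measurable.of_discrete (hint v hv).ne] with u hu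
      exact ih u hu
  rw [lt_top_iff_ne_top]
  intro hw
  obtain ⟨n, hn⟩ := hirr.irreducible (measurableSet_singleton w) (by simp) x
  refine hn.ne' (measure_mono_null ?_ (hpow n x (by simp [hitMean_self])))
  simpa using hw

end Times

end CoverTime

namespace CoverTime

/-! ### Visit counts and lagging events. -/

section Visits

variable {M : Type*}

/-- The number of visits to `x` up to and including time `n`. -/
noncomputable def visits (x : M) (n : ℕ) (ω : ℕ → M) : ℕ :=
  ∑ t ∈ Finset.range (n + 1), Set.indicator {x} (fun _ => 1) (ω t)

lemma visits_cons_zero (x w : M) (ω : ℕ → M) :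
    visits x 0 (cons w ω) = Set.indicator {x} (fun _ => 1) w := by
  simp [visits]

lemma visits_cons_succ (x w : M) (n : ℕ) (ω : ℕ → M) :
    visits x (n + 1) (cons w ω) = visits x n ω + Set.indicator {x} (fun _ => 1) w := by
  rw [visits, Finset.sum_range_succ']
  rfl

lemma visits_mono (x : M) (ω : ℕ → M) {m n : ℕ} (h : m ≤ n) : visits x m ω ≤ visits x n ω :=
  Finset.sum_le_sum_of_subset (Finset.range_mono (by omega))

lemma visits_succ (x : M) (n : ℕ) (ω : ℕ → M) :
    visits x (n + 1) ω = visits x n ω + Set.indicator {x} (fun _ => 1) (ω (n + 1)) :=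
  Finset.sum_range_succ _ _

lemma visits_eq_zero_iff (x : M) (n : ℕ) (ω : ℕ → M) :
    visits x n ω = 0 ↔ ∀ t ≤ n, ω t ≠ x := by
  simp [visits, Finset.sum_eq_zero_iff]

lemma visits_pos_of_eq {x : M} {n : ℕ} {ω : ℕ → M} (h : ω n = x) : 0 < visits x n ω := by
  rw [pos_iff_ne_zero, Ne, visits_eq_zero_iff]
  exact fun h' => h' n le_rfl h

lemma visits_lt_of_lt {x : M} {m n : ℕ} {ω : ℕ → M} (h : m < n) (hn : ω n = x) :
    visits x m ω < visits x n ω := by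
  obtain ⟨k, rfl⟩ : ∃ k, n = k + 1 := ⟨n - 1, by omega⟩
  rw [visits_succ, hn]
  have := visits_mono x ω (show m ≤ k by omega)
  simp
  omega

/-- The set of paths which at some time before `n` have visited `x` more than `k` times, but `y`
at most `m` times. -/
def laggingBefore (x y : M) (k m n : ℕ) : Set (ℕ → M) :=
  {ω | ∃ i < n, k < visits x i ω ∧ visits y i ω ≤ m}

/-- The set of paths which at some time have visited `x` more than `k` times, but `y` at most
`m` times. -/
def lagging (x y : M) (k m : ℕ) : Set (ℕ → M) := {ω | ∃ i, k < visits x i ω ∧ visits y i ω ≤ m}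

lemma lagging_eq_iUnion (x y : M) (k m : ℕ) : lagging x y k m = ⋃ n, laggingBefore x y k m n := by
  ext ω
  simp only [lagging, laggingBefore, Set.mem_ofPred_eq, Set.mem_iUnion]
  exact ⟨fun ⟨i, h⟩ => ⟨i + 1, i, by omega, h⟩, fun ⟨_, i, _, h⟩ => ⟨i, h⟩⟩

lemma lagging_self (x : M) {k m : ℕ} (h : m ≤ k) : lagging x x k m = ∅ := by
  ext ω
  simp only [lagging, Set.mem_ofPred_eq, Set.mem_empty_iff_false, iff_false]
  rintro ⟨i, h1, h2⟩
  omega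

lemma cons_preimage_laggingBefore_self (x y : M) (k m n : ℕ) :
    cons x ⁻¹' laggingBefore x y (k + 1) m (n + 1) ⊆ laggingBefore x y k m n := by
  rintro ω ⟨i, hi, h1, h2⟩
  cases i with
  | zero => simp [visits_cons_zero] at h1
  | succ i =>
    rw [visits_cons_succ] at h1 h2
    simp only [Set.mem_singleton_iff, Set.indicator_of_mem] at h1
    exact ⟨i, by omega, by omega, by omega⟩

lemma cons_preimage_laggingBefore_zero (x y : M) (k n : ℕ) :
    cons y ⁻¹' laggingBefore x y k 0 n = ∅ := by
  ext ω
  simp only [Set.mem_preimage, Set.mem_empty_iff_false, iff_false]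
  rintro ⟨i, hi, h1, h2⟩
  cases i with
  | zero => simp [visits_cons_zero] at h2
  | succ i => simp [visits_cons_succ] at h2

lemma cons_preimage_laggingBefore_right {x y : M} (h : x ≠ y) (k m n : ℕ) :
    cons y ⁻¹' laggingBefore x y k (m + 1) (n + 1) ⊆ laggingBefore x y k m n := by
  rintro ω ⟨i, hi, h1, h2⟩
  cases i with
  | zero => simp [visits_cons_zero, h.symm] at h1
  | succ i =>
    rw [visits_cons_succ] at h1 h2
    simp only [Set.mem_singleton_iff, Set.indicator_of_mem, h.symm, not_false_eq_true,
      Set.indicator_of_notMem] at h1 h2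
    exact ⟨i, by omega, by omega, by omega⟩

lemma cons_preimage_laggingBefore_of_ne {w x y : M} (hx : w ≠ x) (k m n : ℕ) :
    cons w ⁻¹' laggingBefore x y k m (n + 1) ⊆ laggingBefore x y k m n := by
  rintro ω ⟨i, hi, h1, h2⟩
  cases i with
  | zero => simp [visits_cons_zero, hx] at h1
  | succ i =>
    rw [visits_cons_succ] at h1 h2
    simp only [Set.mem_singleton_iff, hx, not_false_eq_true, Set.indicator_of_notMem] at h1
    exact ⟨i, by omega, by omega, by omega⟩

variable [MeasurableSpace M] [Countable M] [MeasurableSingletonClass M]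

lemma measurable_visits (x : M) (n : ℕ) : Measurable (visits x n) := by
  unfold visits
  exact Finset.measurable_sum _ fun t _ =>
    (Measurable.of_discrete (f := Set.indicator {x} fun _ => 1)).comp (measurable_pi_apply t)

lemma measurableSet_laggingBefore (x y : M) (k m n : ℕ) :
    MeasurableSet (laggingBefore x y k m n) := by
  have : laggingBefore x y k m n =
      ⋃ i ∈ Set.Iio n, (visits x i ⁻¹' Set.Ioi k ∩ visits y i ⁻¹' Set.Iic m) := by
    ext; simp [laggingBefore, and_left_comm]
  rw [this]
  exact MeasurableSet.biUnion (Set.to_countable _) fun i _ =>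
    (measurable_visits x i measurableSet_Ioi).inter (measurable_visits y i measurableSet_Iic)

variable (P : Kernel M M) [IsMarkovKernel P]

/-- A supermartingale bound: `ψ` decreases on average off `{x, y}`, while leaving `x` costs a factor
`φ` and leaving `y` a factor `σ`. The time horizon in `laggingBefore` makes this an induction over
first steps. -/
lemma chainLaw_lagging_le_of_supersolution {x y : M} (hxy : x ≠ y) {ψ : M → ℝ≥0∞} {φ σ : ℝ≥0∞}
    (h1 : 1 ≤ ψ x) (hσ : 1 ≤ σ) (hx : ∫⁻ v, ψ v ∂(P x) ≤ φ * ψ x) (hy : ∫⁻ v, ψ v ∂(P y) ≤ σ * ψ y)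
    (hne : ∀ w, w ≠ x → w ≠ y → ∫⁻ v, ψ v ∂(P w) ≤ ψ w) (w : M) (k m : ℕ) :
    chainLaw P w (lagging x y k m) ≤ ψ w * φ ^ k * σ ^ m := by
  have hmono : Monotone (laggingBefore x y k m) :=
    fun a b hab ω ⟨i, hi, h⟩ => ⟨i, lt_of_lt_of_le hi hab, h⟩
  rw [lagging_eq_iUnion, hmono.measure_iUnion]
  refine iSup_le fun n => ?_
  clear hmono
  induction n generalizing w k m with
  | zero => simp [laggingBefore]
  | succ n ih =>
    have step (k' m' : ℕ)
        (hsub : cons w ⁻¹' laggingBefore x y k m (n + 1) ⊆ laggingBefore x y k' m' n) :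
        chainLaw P w (laggingBefore x y k m (n + 1)) ≤
          (∫⁻ v, ψ v ∂(P w)) * φ ^ k' * σ ^ m' := by
      rw [chainLaw_apply P w (measurableSet_laggingBefore ..), mul_assoc,
        ← lintegral_mul_const _ Measurable.of_discrete]
      refine lintegral_mono fun v => (measure_mono hsub).trans ?_
      rw [← mul_assoc]
      exact ih v k' m'
    by_cases hwx : w = x
    · subst hwx
      cases k with
      | zero =>
        -- With no further visit to `x` required, the right side is already at least 1.
        rw [pow_zero, mul_one]
        exact prob_le_one.trans (one_le_mul h1 (one_le_pow_of_one_le' hσ m))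
      | succ k =>
        refine (step k m (cons_preimage_laggingBefore_self _ _ k m n)).trans ?_
        calc _ ≤ φ * ψ w * φ ^ k * σ ^ m := by gcongr
          _ = _ := by ring
    by_cases hwy : w = y
    · subst hwy
      cases m with
      | zero =>
        rw [chainLaw_apply P w (measurableSet_laggingBefore ..)]
        simp [cons_preimage_laggingBefore_zero]
      | succ m =>
        refine (step k m (cons_preimage_laggingBefore_right hxy k m n)).trans ?_
        calc _ ≤ σ * ψ w * φ ^ k * σ ^ m := by gcongr
          _ = _ := by ring
    · refine (step k m (cons_preimage_laggingBefore_of_ne hwx k m n)).trans ?_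
      gcongr
      exact hne w hwx hwy

end Visits

/-! ### Exponential bound for a pair of states. -/

section Pair

variable {M : Type*} [MeasurableSpace M] [Countable M] [MeasurableSingletonClass M]
variable {P : Kernel M M} [IsMarkovKernel P]

/-- A path lags behind with exponentially small probability: the bound is that of the Laplace
transform of a geometric sum of excursion counts. -/
lemma chainLaw_lagging_le (hH : ∀ w x, hitMean P w x ≠ ∞)
    (hR : ∀ x, returnMean P x ≠ ∞) {x y : M} (hxy : x ≠ y)
    {μ : ℝ} (hμ : 0 ≤ μ) (w : M) (k m : ℕ) :
    chainLaw P w (lagging x y k m) ≤ ENNReal.ofReal (Real.exp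
      (-(k * (returnMean P x).toReal / (commuteDist P x y).toReal * (μ / (1 + μ)))
        + m * (returnMean P y).toReal / (commuteDist P x y).toReal * μ)) := by
  set h : M → M → ℝ := fun w x => (hitMean P w x).toReal with hh
  set d := (commuteDist P x y).toReal with hd
  have hd' : d = h x y + h y x := ENNReal.toReal_add (hH _ _) (hH _ _)
  have h0 (w x) : 0 ≤ h w x := ENNReal.toReal_nonneg
  have h1 : 1 ≤ h x y := by
    have := ENNReal.toReal_mono (hH x y) (one_le_hitMean P hxy)
    simpa using this
  have hdpos : 0 < d := by have := h0 y x; linarith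
  have tri (u v t) : h u t ≤ h u v + h v t := by
    rw [hh]
    simp only
    rw [← ENNReal.toReal_add (hH _ _) (hH _ _)]
    exact ENNReal.toReal_mono (ENNReal.add_ne_top.2 ⟨hH _ _, hH _ _⟩) (hitMean_triangle P u v t)
  have hfin (w x) : ∫⁻ v, hitMean P v x ∂(P w) ≠ ∞ := by
    by_cases hwx : w = x
    · subst hwx
      have := hR w
      rw [returnMean_eq] at this
      exact (ENNReal.add_ne_top.1 this).2
    · have := hH w x
      rw [hitMean_of_ne P hwx] at this
      exact (ENNReal.add_ne_top.1 this).2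
  have hint (w x) : Integrable (fun v => h v x) (P w) :=
    integrable_toReal_of_lintegral_ne_top Measurable.of_discrete.aemeasurable (hfin w x)
  have hI (w x) : ∫ v, h v x ∂(P w) = (∫⁻ v, hitMean P v x ∂(P w)).toReal :=
    integral_toReal Measurable.of_discrete.aemeasurable
      (Filter.Eventually.of_forall fun v => (hH v x).lt_top)
  have hne (w x) (hwx : w ≠ x) : ∫ v, h v x ∂(P w) = h w x - 1 := by
    rw [hI, hh]
    simp only
    rw [hitMean_of_ne P hwx, ENNReal.toReal_add (by simp) (hfin w x)]
    simp
  have heq (x) : ∫ v, h v x ∂(P x) = (returnMean P x).toReal - 1 := by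
    rw [hI, returnMean_eq, ENNReal.toReal_add (by simp) (hfin x x)]
    simp
  have hself (x) : h x x = 0 := by simp [hh, hitMean_self]
  -- Chosen so that `1 - c = 1 / (1 + μ)`, which makes the growth factor at `y` exactly `1 + q μ`.
  set c := μ / (1 + μ) with hc
  have hc0 : 0 ≤ c := by positivity
  have hc1 : c ≤ 1 := by rw [hc, div_le_one (by linarith)]; linarith
  set p := (returnMean P x).toReal / d with hp
  set q := (returnMean P y).toReal / d with hq
  have hq0 : 0 ≤ q := by positivity
  have hp0 : 0 ≤ p := by positivity
  -- This is the probability, from `w`, of reaching `y` before `x`, written through mean hitting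
  -- times. Only its harmonicity off `{x, y}`, its boundary values 0 and 1, and its one-step means
  -- `p` at `x` and `1 - q` at `y` are needed; the triangle inequality gives `0 ≤ α ≤ 1`.
  let α : M → ℝ := fun w => (h w x + h x y - h w y) / d
  have hα0 (w) : 0 ≤ α w := div_nonneg (by have := tri w x y; linarith) hdpos.le
  have hα1 (w) : α w ≤ 1 := by
    rw [div_le_one hdpos]; have := tri w y x; linarith
  have hψ0 (w) : 0 ≤ 1 - c * α w := by
    have := mul_le_one₀ hc1 (hα0 w) (hα1 w); linarith
  have hPψ (w : M) : ∫⁻ v, ENNReal.ofReal (1 - c * α v) ∂(P w) = ENNReal.ofReal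
      (1 - c * ((∫ v, h v x ∂(P w) + h x y - ∫ v, h v y ∂(P w)) / d)) := by
    have i1 : Integrable (fun v => h v x + h x y) (P w) := (hint w x).add (integrable_const _)
    have i2 : Integrable α (P w) := (i1.sub (hint w y)).div_const d
    have i3 : Integrable (fun v => 1 - c * α v) (P w) :=
      (integrable_const 1).sub (i2.const_mul c)
    rw [← ofReal_integral_eq_lintegral_ofReal i3 (Filter.Eventually.of_forall hψ0)]
    congr 1
    rw [integral_sub (integrable_const 1) (i2.const_mul c), integral_const_mul, integral_div,
      integral_sub i1 (hint w y), integral_add (hint w x) (integrable_const _)]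
    simp
  have hαx : α x = 0 := by simp [α, hself]
  have hαy : α y = 1 := by
    simp only [α, hself, sub_zero]
    rw [hd', add_comm, div_self]
    linarith
  have hp1 : p ≤ 1 := by
    rw [hp, div_le_one hdpos]
    exact ENNReal.toReal_mono (ENNReal.add_ne_top.2 ⟨hH _ _, hH _ _⟩)
      (returnMean_le_commuteDist P hxy)
  have hcp : 0 ≤ 1 - c * p := by
    have := mul_le_one₀ hc1 hp0 hp1; linarith
  refine (chainLaw_lagging_le_of_supersolution P hxy (ψ := fun w => ENNReal.ofReal (1 - c * α w))
    (φ := ENNReal.ofReal (1 - c * p)) (σ := ENNReal.ofReal (1 + q * μ)) ?_ ?_ ?_ ?_ ?_ w k m).trans ?_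
  · simp [hαx]
  · rw [← ENNReal.ofReal_one]
    exact ENNReal.ofReal_le_ofReal (by have := mul_nonneg hq0 hμ; linarith)
  · rw [hPψ, heq, hne _ _ hxy, hαx]
    simp only [mul_zero, sub_zero, ENNReal.ofReal_one, mul_one]
    apply le_of_eq
    congr 3
    rw [hp]; congr 1; ring
  · rw [hPψ, heq, hne _ _ hxy.symm, hαy, ← ENNReal.ofReal_mul (by positivity)]
    apply le_of_eq
    congr 1
    have e1 : (h y x - 1 + h x y - ((returnMean P y).toReal - 1)) / d = 1 - q := by
      rw [hq, eq_sub_iff_add_eq, ← add_div, div_eq_one_iff_eq hdpos.ne', hd']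
      ring
    rw [e1, hc]
    field_simp
    ring
  · intro u hux huy
    rw [hPψ, hne _ _ hux, hne _ _ huy]
    apply le_of_eq
    congr 3
    simp only [α]
    congr 1; ring
  · rw [← ENNReal.ofReal_pow hcp, ← ENNReal.ofReal_pow (by positivity),
      ← ENNReal.ofReal_mul (hψ0 w), ← ENNReal.ofReal_mul (by have := hψ0 w; positivity)]
    refine ENNReal.ofReal_le_ofReal ?_
    have b1 : 1 - c * α w ≤ 1 := by have := mul_nonneg hc0 (hα0 w); linarith
    have b2 : (1 - c * p) ^ k ≤ Real.exp (-(c * p)) ^ k := by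
      gcongr
      have := Real.add_one_le_exp (-(c * p)); linarith
    have b3 : (1 + q * μ) ^ m ≤ Real.exp (q * μ) ^ m := by
      gcongr
      have := Real.add_one_le_exp (q * μ); linarith
    calc _ ≤ 1 * Real.exp (-(c * p)) ^ k * Real.exp (q * μ) ^ m := by gcongr
      _ = _ := by
        rw [one_mul, ← Real.exp_nat_mul, ← Real.exp_nat_mul, ← Real.exp_add]
        congr 1
        rw [hp, hq]
        ring

end Pair

end CoverTime

namespace CoverTime

/-! ### Cover time and visits to the starting point. -/

section Renewal

variable {M : Type*}

/-- The set of paths that are at `z` at time `n` and have not yet visited all of `A`. -/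
def atNotCovered (z : M) (A : Set M) (n : ℕ) : Set (ℕ → M) := {ω | ω n = z} ∩ notCovered A n

/-- The set of paths that have not visited all of `A` at their visit number `j`, counted from `0`,
to `z`. -/
def notCoveredAtVisit (z : M) (A : Set M) (j : ℕ) : Set (ℕ → M) :=
  ⋃ n, atNotCovered z A n ∩ {ω | visits z n ω = j + 1}

lemma cons_preimage_atNotCovered_succ (w z : M) (A : Set M) (n : ℕ) :
    cons w ⁻¹' atNotCovered z A (n + 1) = atNotCovered z (A \ {w}) n := by
  rw [atNotCovered, Set.preimage_inter, cons_preimage_notCovered_succ]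
  rfl

variable [MeasurableSpace M] [Countable M] [MeasurableSingletonClass M]

lemma measurableSet_atNotCovered (z : M) (A : Set M) (n : ℕ) :
    MeasurableSet (atNotCovered z A n) :=
  (measurableSet_eval n {z}).inter (measurableSet_notCovered A n)

variable (P : Kernel M M) [IsMarkovKernel P]

lemma chainLaw_atNotCovered_succ (w z : M) (A : Set M) (n : ℕ) :
    chainLaw P w (atNotCovered z A (n + 1)) =
      ∫⁻ v, chainLaw P v (atNotCovered z (A \ {w}) n) ∂(P w) := by
  rw [chainLaw_apply P w (measurableSet_atNotCovered z A _), cons_preimage_atNotCovered_succ]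

/-- Time before covering lies in the initial stretch up to `z` and in the excursions from `z` begun
before covering, each of mean length `returnMean P z`. Truncation at `n` turns this into an
induction over first steps. -/
lemma sum_chainLaw_notCovered_le (z : M) (n : ℕ) (w : M) (A : Set M) :
    ∑ i ∈ Finset.range n, chainLaw P w (notCovered A i) ≤
      hitMean P w z + returnMean P z * ∑ i ∈ Finset.range n, chainLaw P w (atNotCovered z A i) := by
  classical
  induction n generalizing w A with
  | zero => simp
  | succ n ih =>
    rw [Finset.sum_range_succ', Finset.sum_range_succ', chainLaw_notCovered_zero]
    simp_rw [chainLaw_notCovered_succ, chainLaw_atNotCovered_succ]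
    rw [← lintegral_finsetSum _ fun i _ => Measurable.of_discrete,
      ← lintegral_finsetSum _ fun i _ => Measurable.of_discrete]
    by_cases hA : (A \ {w}).Nonempty
    swap
    · rw [Set.not_nonempty_iff_eq_empty] at hA
      simp [hA, notCovered_empty]
    rw [if_pos hA, mul_add, ← lintegral_const_mul _ Measurable.of_discrete]
    have hle : ∫⁻ v, ∑ i ∈ Finset.range n, chainLaw P v (notCovered (A \ {w}) i) ∂(P w) + 1 ≤
        (1 + ∫⁻ v, hitMean P v z ∂(P w)) + ∫⁻ v, returnMean P z *
          ∑ i ∈ Finset.range n, chainLaw P v (atNotCovered z (A \ {w}) i) ∂(P w) := by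
      rw [add_comm, add_assoc, ← lintegral_add_left Measurable.of_discrete]
      gcongr with v
      exact ih v _
    refine hle.trans ?_
    by_cases hw : w = z
    · subst hw
      have h0 : chainLaw P w (atNotCovered w A 0) = 1 := by
        rw [chainLaw_apply P w (measurableSet_atNotCovered w A 0), atNotCovered,
          Set.preimage_inter, cons_preimage_notCovered_zero]
        simp [hA]
      rw [h0, mul_one, ← returnMean_eq, hitMean_self, zero_add, add_comm]
    · rw [← hitMean_of_ne P hw]
      gcongr
      exact le_self_add

lemma expectedCoverTime_le_tsum_atNotCovered (z : M) (A : Set M) :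
    expectedCoverTime P z A ≤ returnMean P z * ∑' n, chainLaw P z (atNotCovered z A n) := by
  rw [expectedCoverTime_eq_tsum, ENNReal.tsum_eq_iSup_nat]
  refine iSup_le fun n => (sum_chainLaw_notCovered_le P z n z A).trans ?_
  rw [hitMean_self, zero_add]
  gcongr
  exact ENNReal.sum_le_tsum _

/-- The expected cover time is at most the expected return time to `z` times the expected number
of visits to `z` before the cover time. -/
lemma expectedCoverTime_le (z : M) (A : Set M) :
    expectedCoverTime P z A ≤ returnMean P z * ∑' j, chainLaw P z (notCoveredAtVisit z A j) := by
  refine (expectedCoverTime_le_tsum_atNotCovered P z A).trans ?_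
  gcongr returnMean P z * ?_
  have hm (n j : ℕ) : MeasurableSet (atNotCovered z A n ∩ {ω | visits z n ω = j + 1}) :=
    (measurableSet_atNotCovered z A n).inter (measurable_visits z n (measurableSet_singleton _))
  have hn (n : ℕ) : chainLaw P z (atNotCovered z A n) ≤
      ∑' j, chainLaw P z (atNotCovered z A n ∩ {ω | visits z n ω = j + 1}) := by
    have hsub : atNotCovered z A n ⊆
        ⋃ j, (atNotCovered z A n ∩ {ω | visits z n ω = j + 1}) := fun ω hω =>
      Set.mem_iUnion.2 ⟨visits z n ω - 1, hω,
        (Nat.sub_add_cancel (Nat.succ_le_of_lt (visits_pos_of_eq hω.1))).symm⟩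
    exact (measure_mono hsub).trans (measure_iUnion_le _)
  calc _ ≤ ∑' n, ∑' j, chainLaw P z (atNotCovered z A n ∩ {ω | visits z n ω = j + 1}) :=
        ENNReal.tsum_le_tsum hn
    _ = ∑' j, ∑' n, chainLaw P z (atNotCovered z A n ∩ {ω | visits z n ω = j + 1}) :=
        ENNReal.tsum_comm
    _ ≤ _ := by
        refine ENNReal.tsum_le_tsum fun j => ?_
        rw [notCoveredAtVisit, measure_iUnion _ fun n => hm n j]
        -- Visit number `j` to `z` happens at one time only, so the events are disjoint in `n`.
        intro m n hmn
        refine Set.disjoint_left.2 fun ω h1 h2 => ?_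
        have e1 : visits z m ω = j + 1 := h1.2
        have e2 : visits z n ω = j + 1 := h2.2
        rcases lt_or_gt_of_ne hmn with h | h
        · have := visits_lt_of_lt h h2.1.1; omega
        · have := visits_lt_of_lt h h1.1.1; omega

lemma expectedCoverTime_eq_zero_of_subset {z : M} {A : Set M} (hA : A ⊆ {z}) :
    expectedCoverTime P z A = 0 := by
  classical
  have h : A \ {z} = ∅ := Set.sdiff_eq_empty.2 hA
  rw [expectedCoverTime_eq_tsum, ENNReal.tsum_eq_zero]
  intro n
  cases n with
  | zero => simp [chainLaw_notCovered_zero, h]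
  | succ n => simp [chainLaw_notCovered_succ, h, notCovered_empty]

end Renewal

end CoverTime

namespace CoverTime

/-! ### Admissible partitions and representatives. -/

section PartitionFacts

variable {M : Type*} {A : Set M}

lemma partOf_eq_of_refines {Q Q' : Partition A} (h : Q ≤ Q') {x y : M} (hx : x ∈ A) (hy : y ∈ A)
    (hxy : Q.partOf x = Q.partOf y) : Q'.partOf x = Q'.partOf y := by
  rw [← Partition.rel_iff_partOf_eq_partOf_of_mem _ hx hy] at hxy ⊢
  exact Partition.rel_le_iff_le.2 h _ _ hxy

lemma IsAdmissible.partOf_eq_of_le {𝒜 : ℕ → Partition A} (h𝒜 : IsAdmissible 𝒜) {x y : M}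
    (hx : x ∈ A) (hy : y ∈ A) {m n : ℕ} (hmn : m ≤ n)
    (hxy : (𝒜 n).partOf x = (𝒜 n).partOf y) : (𝒜 m).partOf x = (𝒜 m).partOf y :=
  partOf_eq_of_refines (antitone_nat_of_succ_le h𝒜.refines hmn) hx hy hxy

lemma IsAdmissible.partOf_anti {𝒜 : ℕ → Partition A} (h𝒜 : IsAdmissible 𝒜) (x : M) {m n : ℕ}
    (hmn : m ≤ n) : (𝒜 n).partOf x ⊆ (𝒜 m).partOf x := fun _ hy =>
  Partition.rel_le_iff_le.2 (antitone_nat_of_succ_le h𝒜.refines hmn) _ _ hy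

/-- A finite set of points of `A` that meets every part. -/
lemma IsAdmissible.exists_representatives {𝒜 : ℕ → Partition A} (h𝒜 : IsAdmissible 𝒜) (n : ℕ) :
    ∃ T : Finset M, T.card ≤ chainCard n ∧ (∀ y ∈ T, y ∈ A) ∧
      ∀ x ∈ A, ∃ y ∈ T, (𝒜 n).partOf x = (𝒜 n).partOf y := by
  classical
  have hfin : {B : Set M | B ∈ 𝒜 n}.Finite :=
    Set.finite_of_encard_le_coe (h𝒜.encard_le n)
  have hcard : hfin.toFinset.card ≤ chainCard n := by
    have := h𝒜.encard_le n
    rw [hfin.encard_eq_coe_toFinset_card] at this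
    exact_mod_cast this
  refine ⟨hfin.toFinset.attach.image fun B => (𝒜 n).rep (hfin.mem_toFinset.1 B.2),
    Finset.card_image_le.trans (by simpa using hcard), ?_, ?_⟩
  · intro y hy
    obtain ⟨B, -, rfl⟩ := Finset.mem_image.1 hy
    exact Partition.rep_mem_supp _
  · intro x hx
    have hB := (𝒜 n).partOf_mem hx
    exact ⟨(𝒜 n).rep hB, Finset.mem_image.2 ⟨⟨_, hfin.mem_toFinset.2 hB⟩, by simp, rfl⟩,
      (Partition.partOf_rep hB).symm⟩

lemma IsAdmissible.partOf_zero_eq {𝒜 : ℕ → Partition A} (h𝒜 : IsAdmissible 𝒜) {x y : M}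
    (hx : x ∈ A) (hy : y ∈ A) : (𝒜 0).partOf x = (𝒜 0).partOf y := by
  have h := h𝒜.encard_le 0
  simp only [chainCard, if_true, Nat.cast_one] at h
  exact Set.encard_le_one_iff.1 h _ _ ((𝒜 0).partOf_mem hx) ((𝒜 0).partOf_mem hy)

open Classical in
/-- A point of `B`, which is `z` if `z ∈ B`. -/
noncomputable def anchor (z : M) (B : Set M) : M :=
  if z ∈ B then z else if h : B.Nonempty then h.some else z

lemma anchor_mem (z : M) {B : Set M} (h : B.Nonempty) : anchor z B ∈ B := by
  unfold anchor
  split_ifs with h1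
  · exact h1
  · exact h.some_mem

lemma anchor_of_mem {z : M} {B : Set M} (h : z ∈ B) : anchor z B = z := if_pos h

end PartitionFacts

/-! ### Numerical series. -/

section Numeric

lemma exp_two_and_half_ge : (12 : ℝ) ≤ Real.exp (5 / 2) := by
  have h := Real.exp_one_gt_d9
  have e : Real.exp (5 / 2) ^ 2 = Real.exp 1 ^ 5 := by
    rw [← Real.exp_nat_mul, ← Real.exp_nat_mul]; norm_num
  have h5 : (144 : ℝ) ≤ Real.exp 1 ^ 5 :=
    calc (144 : ℝ) ≤ 2.718 ^ 5 := by norm_num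
      _ ≤ _ := by gcongr; linarith
  nlinarith [Real.exp_pos (5 / 2)]

lemma exp_two_and_half_le : Real.exp (5 / 2) ≤ 17 := by
  have h := Real.exp_one_lt_d9
  have e : Real.exp (5 / 2) ^ 2 = Real.exp 1 ^ 5 := by
    rw [← Real.exp_nat_mul, ← Real.exp_nat_mul]; norm_num
  have h5 : Real.exp 1 ^ 5 ≤ 289 :=
    calc Real.exp 1 ^ 5 ≤ 2.72 ^ 5 := by gcongr; linarith
      _ ≤ _ := by norm_num
  nlinarith [Real.exp_pos (5 / 2)]

/-- The union bound over all the levels of the chaining. -/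
lemma tsum_chainCard_mul_exp_le {t : ℝ} (ht : 5 / 2 ≤ t) :
    ∑' n : ℕ, (chainCard (n + 1) : ℝ≥0∞) * ENNReal.ofReal (Real.exp (1 - t * 2 ^ n)) ≤
      ENNReal.ofReal (17 * Real.exp (-t)) := by
  -- Since `N_(n+1) = 4^(2^n)`, each term is `e (4 exp(-t))^(2^n)`; the threshold `5/2` makes the
  -- base at most `1/3`.
  have h4 : 4 * Real.exp (-t) ≤ 1 / 3 := by
    have h1 : Real.exp (-t) ≤ Real.exp (-(5 / 2)) := Real.exp_le_exp.2 (by linarith)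
    rw [Real.exp_neg (5 / 2)] at h1
    have h2 : (Real.exp (5 / 2))⁻¹ ≤ 12⁻¹ := inv_anti₀ (by norm_num) exp_two_and_half_ge
    linarith
  have hterm (n : ℕ) : (chainCard (n + 1) : ℝ≥0∞) * ENNReal.ofReal (Real.exp (1 - t * 2 ^ n)) ≤
      ENNReal.ofReal (4 * Real.exp 1 * Real.exp (-t) * (1 / 3) ^ n) := by
    have e1 : (chainCard (n + 1) : ℝ≥0∞) = ENNReal.ofReal (4 ^ 2 ^ n) := by
      rw [chainCard, if_neg (Nat.succ_ne_zero n)]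
      rw [ENNReal.ofReal_pow (by norm_num)]
      push_cast
      rw [pow_succ' 2 n, pow_mul]
      norm_num
    rw [e1, ← ENNReal.ofReal_mul (by positivity)]
    refine ENNReal.ofReal_le_ofReal ?_
    have e2 : (4 : ℝ) ^ 2 ^ n * Real.exp (1 - t * 2 ^ n) =
        Real.exp 1 * (4 * Real.exp (-t)) ^ 2 ^ n := by
      rw [mul_pow, ← Real.exp_nat_mul, sub_eq_add_neg, Real.exp_add]
      push_cast
      rw [show (2 : ℝ) ^ n * -t = -(t * 2 ^ n) by ring]
      ring
    rw [e2]
    have h3 : (4 * Real.exp (-t)) ^ 2 ^ n ≤ (4 * Real.exp (-t)) ^ (n + 1) :=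
      pow_le_pow_of_le_one (by positivity) (by linarith) Nat.lt_two_pow_self
    have h5 : (4 * Real.exp (-t)) ^ (n + 1) ≤ (1 / 3) ^ n * (4 * Real.exp (-t)) := by
      rw [pow_succ]; gcongr
    calc _ ≤ Real.exp 1 * ((1 / 3) ^ n * (4 * Real.exp (-t))) := by gcongr; exact h3.trans h5
      _ = _ := by ring
  refine (ENNReal.tsum_le_tsum hterm).trans ?_
  have hs : Summable fun n : ℕ => 4 * Real.exp 1 * Real.exp (-t) * (1 / 3 : ℝ) ^ n :=
    (summable_geometric_of_lt_one (by norm_num) (by norm_num)).mul_left _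
  rw [← ENNReal.ofReal_tsum_of_nonneg (fun n => by positivity) hs, tsum_mul_left,
    tsum_geometric_of_lt_one (by norm_num) (by norm_num)]
  refine ENNReal.ofReal_le_ofReal ?_
  -- The geometric series has sum `3/2`, and `4e · 3/2 = 6e < 17`.
  have := Real.exp_one_lt_d9
  have := Real.exp_pos (-t)
  norm_num
  nlinarith

lemma tsum_exp_le {a : ℝ} (ha : 0 < a) :
    ∑' j : ℕ, ENNReal.ofReal (17 * Real.exp (-(j * a))) ≤ ENNReal.ofReal (17 * (1 + 1 / a)) := by
  have hr : Real.exp (-a) < 1 := by simpa using ha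
  have e (j : ℕ) : 17 * Real.exp (-(j * a)) = 17 * Real.exp (-a) ^ j := by
    rw [← Real.exp_nat_mul]; congr 2; ring
  simp_rw [e]
  rw [← ENNReal.ofReal_tsum_of_nonneg (fun n => by positivity)
    ((summable_geometric_of_lt_one (Real.exp_pos _).le hr).mul_left _), tsum_mul_left,
    tsum_geometric_of_lt_one (Real.exp_pos _).le hr]
  refine ENNReal.ofReal_le_ofReal ?_
  gcongr
  have h1 : Real.exp (-a) ≤ (1 + a)⁻¹ := by
    rw [Real.exp_neg]
    exact inv_anti₀ (by linarith) (by linarith [Real.add_one_le_exp a])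
  have h2 : 1 - (1 + a)⁻¹ = a / (1 + a) := by field_simp; ring
  calc (1 - Real.exp (-a))⁻¹ ≤ (a / (1 + a))⁻¹ := inv_anti₀ (by positivity) (by linarith)
    _ = _ := by field_simp; ring

end Numeric

/-! ### The subgaussian increment bound. -/

section Step

variable {M : Type*} [MeasurableSpace M] [Countable M] [MeasurableSingletonClass M]
variable {P : Kernel M M} [IsMarkovKernel P]

/-- The lagging bound at the optimal parameter, with the thresholds rounded down. -/
lemma chainLaw_lagging_floor_le (hH : ∀ w x, hitMean P w x ≠ ∞)
    (hR : ∀ x, returnMean P x ≠ ∞) {x y : M} {u v r : ℝ} (hv : 0 < v) (huv : v ≤ u)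
    (hr : r * (commuteDist P x y).toReal ≤ (u - v) ^ 2) (w : M) :
    chainLaw P w (lagging x y ⌊u ^ 2 / (returnMean P x).toReal⌋₊
      ⌊v ^ 2 / (returnMean P y).toReal⌋₊) ≤ ENNReal.ofReal (Real.exp (1 - r)) := by
  have hR1 (x : M) : 1 ≤ (returnMean P x).toReal := by
    simpa using ENNReal.toReal_mono (hR x) (one_le_returnMean P x)
  by_cases hxy : x = y
  · subst hxy
    rw [lagging_self]
    · simp
    · have := hR1 x
      gcongr
  have hdR : (returnMean P x).toReal ≤ (commuteDist P x y).toReal :=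
    ENNReal.toReal_mono (ENNReal.add_ne_top.2 ⟨hH _ _, hH _ _⟩) (returnMean_le_commuteDist P hxy)
  have hx1 := hR1 x
  have hy1 := hR1 y
  set d := (commuteDist P x y).toReal
  set Rx := (returnMean P x).toReal
  set Ry := (returnMean P y).toReal
  have hu : 0 < u := hv.trans_le huv
  have hd : 0 < d := by linarith
  -- The value `μ = u/v - 1` minimises `-u² μ/(1 + μ) + v² μ`, with minimum `-(u - v)²`.
  have hμ : 0 ≤ u / v - 1 := by rw [sub_nonneg, le_div_iff₀ hv]; linarith
  refine (chainLaw_lagging_le hH hR hxy hμ w _ _).trans (ENNReal.ofReal_le_ofReal ?_)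
  refine Real.exp_le_exp.2 ?_
  change -((⌊u ^ 2 / Rx⌋₊ : ℝ) * Rx / d * _) + (⌊v ^ 2 / Ry⌋₊ : ℝ) * Ry / d * _ ≤ _
  -- Rounding down loses less than one visit, of weight `Rx ≤ d`. This costs at most `(u - v)/u ≤ 1`
  -- in the exponent, hence the 1 in `exp (1 - r)`.
  have hk : u ^ 2 - d ≤ (⌊u ^ 2 / Rx⌋₊ : ℝ) * Rx := by
    have h1 := (Nat.lt_floor_add_one (u ^ 2 / Rx)).le
    rw [div_le_iff₀ (by linarith)] at h1
    linarith
  have hm : (⌊v ^ 2 / Ry⌋₊ : ℝ) * Ry ≤ v ^ 2 := by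
    have h1 := Nat.floor_le (a := v ^ 2 / Ry) (by positivity)
    rwa [le_div_iff₀ (by linarith)] at h1
  have hu' := hu.ne'
  have e1 : (u / v - 1) / (1 + (u / v - 1)) = (u - v) / u := by
    rw [add_sub_cancel]; field_simp
  have e2 : u / v - 1 = (u - v) / v := by field_simp
  rw [e1, e2]
  have f1 : (u ^ 2 - d) / d * ((u - v) / u) ≤ (⌊u ^ 2 / Rx⌋₊ : ℝ) * Rx / d * ((u - v) / u) := by
    have : 0 ≤ u - v := by linarith
    gcongr
  have f2 : (⌊v ^ 2 / Ry⌋₊ : ℝ) * Ry / d * ((u - v) / v) ≤ v ^ 2 / d * ((u - v) / v) := by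
    have : 0 ≤ u - v := by linarith
    gcongr
  have f3 : -((u ^ 2 - d) / d * ((u - v) / u)) + v ^ 2 / d * ((u - v) / v) =
      -((u - v) ^ 2 / d) + (u - v) / u := by
    field_simp; ring
  have f4 : (u - v) / u ≤ 1 := by rw [div_le_one hu]; linarith
  have f5 : r ≤ (u - v) ^ 2 / d := by rwa [le_div_iff₀ hd]
  linarith

end Step

end CoverTime

namespace CoverTime

/-! ### The chaining argument. -/

section Chaining

variable {M : Type*} [MeasurableSpace M] {A : Set M}

/-- The term `2^(n/2) √Δ(A_n(x))` of the chaining functional. -/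
noncomputable def chainTerm (P : Kernel M M) [IsMarkovKernel P] (𝒜 : ℕ → Partition A) (n : ℕ)
    (x : M) : ℝ≥0∞ :=
  (2 : ℝ≥0∞) ^ ((n : ℝ) / 2) * (diam (commuteDist P) ((𝒜 n).partOf x)) ^ (1 / 2 : ℝ)

lemma chainTerm_sq (P : Kernel M M) [IsMarkovKernel P] (𝒜 : ℕ → Partition A) (n : ℕ) (x : M) :
    chainTerm P 𝒜 n x ^ 2 = 2 ^ n * diam (commuteDist P) ((𝒜 n).partOf x) := by
  rw [chainTerm, mul_pow, ← ENNReal.rpow_natCast, ← ENNReal.rpow_natCast, ← ENNReal.rpow_mul,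
    ← ENNReal.rpow_mul]
  norm_num

lemma le_chainTerm_sq (P : Kernel M M) [IsMarkovKernel P] (𝒜 : ℕ → Partition A) (n : ℕ) (x : M)
    {a b : M} (ha : a ∈ (𝒜 n).partOf x) (hb : b ∈ (𝒜 n).partOf x) :
    2 ^ n * commuteDist P a b ≤ chainTerm P 𝒜 n x ^ 2 := by
  rw [chainTerm_sq]
  gcongr
  exact le_iSup₂_of_le a ha (le_iSup₂_of_le b hb le_rfl)

/-- The representative of `A_n(x)`. -/
noncomputable def chainPoint (z : M) (𝒜 : ℕ → Partition A) (n : ℕ) (x : M) : M :=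
  anchor z ((𝒜 n).partOf x)

/-- The square root of the local time that `chainPoint z 𝒜 n x` is to have. -/
noncomputable def chainLevel (P : Kernel M M) [IsMarkovKernel P] (𝒜 : ℕ → Partition A)
    (u B : ℝ) (n : ℕ) (x : M) : ℝ :=
  u * (1 - (∑ k ∈ Finset.range n, (chainTerm P 𝒜 k x).toReal) / B)

/-- The number of returns that `chainPoint z 𝒜 n x` is to have. -/
noncomputable def chainCount (P : Kernel M M) [IsMarkovKernel P] (z : M) (𝒜 : ℕ → Partition A)
    (u B : ℝ) (n : ℕ) (x : M) : ℕ :=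
  ⌊chainLevel P 𝒜 u B n x ^ 2 / (returnMean P (chainPoint z 𝒜 n x)).toReal⌋₊

/-- The set of paths on which the chain of `x` breaks between the levels `n` and `n + 1`. -/
noncomputable def chainBreak (P : Kernel M M) [IsMarkovKernel P] (z : M) (𝒜 : ℕ → Partition A)
    (u B : ℝ) (n : ℕ) (x : M) : Set (ℕ → M) :=
  lagging (chainPoint z 𝒜 n x) (chainPoint z 𝒜 (n + 1) x)
    (chainCount P z 𝒜 u B n x) (chainCount P z 𝒜 u B (n + 1) x)

variable {P : Kernel M M} [IsMarkovKernel P] {𝒜 : ℕ → Partition A} {z : M} {u B S : ℝ}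

lemma chainPoint_mem {x : M} (hx : x ∈ A) (n : ℕ) : chainPoint z 𝒜 n x ∈ (𝒜 n).partOf x :=
  anchor_mem z ⟨x, (𝒜 n).mem_partOf hx⟩

lemma chainPoint_zero (h𝒜 : IsAdmissible 𝒜) (hz : z ∈ A) {x : M} (hx : x ∈ A) :
    chainPoint z 𝒜 0 x = z :=
  anchor_of_mem (h𝒜.partOf_zero_eq hz hx ▸ (𝒜 0).mem_partOf hz)

/-- Representatives and levels up to `n + 1` depend only on the parts containing the point, and the
part at level `n + 1` determines the coarser ones. This limits the union bound to `N_(n+1)` events.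
-/
lemma IsAdmissible.chainBreak_congr (h𝒜 : IsAdmissible 𝒜) {x y : M} (hx : x ∈ A) (hy : y ∈ A)
    {n : ℕ} (hxy : (𝒜 (n + 1)).partOf x = (𝒜 (n + 1)).partOf y) :
    chainBreak P z 𝒜 u B n x = chainBreak P z 𝒜 u B n y := by
  have hpart (m : ℕ) (hm : m ≤ n + 1) : (𝒜 m).partOf x = (𝒜 m).partOf y :=
    h𝒜.partOf_eq_of_le hx hy hm hxy
  have hpoint (m : ℕ) (hm : m ≤ n + 1) : chainPoint z 𝒜 m x = chainPoint z 𝒜 m y := by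
    rw [chainPoint, chainPoint, hpart m hm]
  have hcount (m : ℕ) (hm : m ≤ n + 1) :
      chainCount P z 𝒜 u B m x = chainCount P z 𝒜 u B m y := by
    have hsum : ∑ k ∈ Finset.range m, (chainTerm P 𝒜 k x).toReal =
        ∑ k ∈ Finset.range m, (chainTerm P 𝒜 k y).toReal := by
      refine Finset.sum_congr rfl fun k hk => ?_
      rw [chainTerm, chainTerm, hpart k (by have := Finset.mem_range.1 hk; omega)]
    rw [chainCount, chainCount, chainLevel, chainLevel, hsum, hpoint m hm]
  rw [chainBreak, chainBreak, hpoint n (by omega), hpoint (n + 1) le_rfl, hcount n (by omega),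
    hcount (n + 1) le_rfl]

lemma chainTerm_ne_top {x : M} (hS : ∑' n, chainTerm P 𝒜 n x ≤ ENNReal.ofReal S) (n : ℕ) :
    chainTerm P 𝒜 n x ≠ ∞ :=
  (((ENNReal.le_tsum n).trans hS).trans_lt ENNReal.ofReal_lt_top).ne

lemma sum_chainTerm_le (hS0 : 0 ≤ S) {x : M} (hS : ∑' n, chainTerm P 𝒜 n x ≤ ENNReal.ofReal S)
    (n : ℕ) : ∑ k ∈ Finset.range n, (chainTerm P 𝒜 k x).toReal ≤ S := by
  rw [← ENNReal.toReal_sum fun k _ => chainTerm_ne_top hS k]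
  exact ENNReal.toReal_le_of_le_ofReal hS0 ((ENNReal.sum_le_tsum _).trans hS)

lemma le_chainTerm_toReal_sq {x : M} (hS : ∑' n, chainTerm P 𝒜 n x ≤ ENNReal.ofReal S)
    {n : ℕ} {a b : M} (ha : a ∈ (𝒜 n).partOf x) (hb : b ∈ (𝒜 n).partOf x) :
    2 ^ n * (commuteDist P a b).toReal ≤ (chainTerm P 𝒜 n x).toReal ^ 2 := by
  have := ENNReal.toReal_mono (ENNReal.pow_ne_top (chainTerm_ne_top hS n))
    (le_chainTerm_sq P 𝒜 n x ha hb)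
  simpa using this

variable [Countable M] [MeasurableSingletonClass M]

/-- Distinct states are at commute distance at least 1, so a representative other than `x` at level
`n` forces `2^n ≤ S²`. Every chain thus ends after finitely many links, even for infinite `A`. -/
lemma exists_forall_chainPoint_eq (hH : ∀ w x, hitMean P w x ≠ ∞) (hS0 : 0 ≤ S) {x : M}
    (hx : x ∈ A) (hS : ∑' n, chainTerm P 𝒜 n x ≤ ENNReal.ofReal S) :
    ∃ n, chainPoint z 𝒜 n x = x := by
  obtain ⟨n, hn⟩ := pow_unbounded_of_one_lt (S ^ 2) (one_lt_two (α := ℝ))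
  refine ⟨n, by_contra fun hne => ?_⟩
  have h1 := le_chainTerm_toReal_sq hS (chainPoint_mem (z := z) hx n) ((𝒜 n).mem_partOf hx)
  have h2 : 1 ≤ (commuteDist P (chainPoint z 𝒜 n x) x).toReal := by
    rw [← ENNReal.toReal_one]
    exact ENNReal.toReal_mono (ENNReal.add_ne_top.2 ⟨hH _ _, hH _ _⟩)
      ((one_le_hitMean P hne).trans (le_add_right le_rfl))
  have h3 : (chainTerm P 𝒜 n x).toReal ≤ S :=
    ENNReal.toReal_le_of_le_ofReal hS0 ((ENNReal.le_tsum n).trans hS)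
  have h4 : (chainTerm P 𝒜 n x).toReal ^ 2 ≤ S ^ 2 := by gcongr
  nlinarith [pow_pos (two_pos (α := ℝ)) n]

/-- The drop in level is `u/B` times the chaining term, whose square dominates `2^n` times the
commute distance of the link; the diameters cancel. -/
lemma chainLaw_chainBreak_le (hH : ∀ w x, hitMean P w x ≠ ∞) (hR : ∀ x, returnMean P x ≠ ∞)
    (h𝒜 : IsAdmissible 𝒜) (hS0 : 0 ≤ S) (hSB : S < B) (hu : 0 < u) {x : M} (hx : x ∈ A)
    (hS : ∑' n, chainTerm P 𝒜 n x ≤ ENNReal.ofReal S) (n : ℕ) (w : M) :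
    chainLaw P w (chainBreak P z 𝒜 u B n x) ≤
      ENNReal.ofReal (Real.exp (1 - u ^ 2 / B ^ 2 * 2 ^ n)) := by
  have hB : 0 < B := hS0.trans_lt hSB
  have hdiff : chainLevel P 𝒜 u B n x - chainLevel P 𝒜 u B (n + 1) x =
      u * (chainTerm P 𝒜 n x).toReal / B := by
    rw [chainLevel, chainLevel, Finset.sum_range_succ]
    ring
  refine chainLaw_lagging_floor_le hH hR ?_ ?_ ?_ w
  · have h1 := sum_chainTerm_le hS0 hS (n + 1)
    refine mul_pos hu (sub_pos.2 ?_)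
    rw [div_lt_one hB]
    linarith
  · have : 0 ≤ u * (chainTerm P 𝒜 n x).toReal / B := by positivity
    linarith
  · have h1 := le_chainTerm_toReal_sq hS (chainPoint_mem (z := z) hx n)
      (h𝒜.partOf_anti x n.le_succ (chainPoint_mem (z := z) hx (n + 1)))
    rw [hdiff]
    calc _ = u ^ 2 / B ^ 2 * (2 ^ n * (commuteDist P (chainPoint z 𝒜 n x)
          (chainPoint z 𝒜 (n + 1) x)).toReal) := by ring
      _ ≤ u ^ 2 / B ^ 2 * (chainTerm P 𝒜 n x).toReal ^ 2 := by gcongr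
      _ = _ := by ring

lemma notCoveredAtVisit_subset (hH : ∀ w x, hitMean P w x ≠ ∞) (hR : returnMean P z ≠ ∞)
    (h𝒜 : IsAdmissible 𝒜) (hz : z ∈ A) (hS0 : 0 ≤ S)
    (hS : ∀ x ∈ A, ∑' n, chainTerm P 𝒜 n x ≤ ENNReal.ofReal S) {j : ℕ}
    (hu : u ^ 2 = j * (returnMean P z).toReal) :
    notCoveredAtVisit z A j ⊆ ⋃ n, ⋃ x ∈ A, chainBreak P z 𝒜 u B n x := by
  intro ω hω
  obtain ⟨N, ⟨-, x, hx, hxN⟩, hv⟩ := Set.mem_iUnion.1 hω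
  have hv : visits z N ω = j + 1 := hv
  -- Visits are numbered from 0, so `z` has `j + 1` visits against a required count of exactly `j`.
  have h0 : chainCount P z 𝒜 u B 0 x < visits (chainPoint z 𝒜 0 x) N ω := by
    have hR1 : 1 ≤ (returnMean P z).toReal := by
      simpa using ENNReal.toReal_mono hR (one_le_returnMean P z)
    have : u ^ 2 / (returnMean P z).toReal = j := by rw [hu]; field_simp
    rw [chainCount, chainPoint_zero h𝒜 hz hx, hv, chainLevel]
    simp [this]
  obtain ⟨m, hm⟩ := exists_forall_chainPoint_eq (z := z) hH hS0 hx (hS x hx)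
  have hend : ¬ chainCount P z 𝒜 u B m x < visits (chainPoint z 𝒜 m x) N ω := by
    rw [hm, (visits_eq_zero_iff x N ω).2 hxN]
    omega
  obtain ⟨n, hn, hn'⟩ : ∃ n, chainCount P z 𝒜 u B n x < visits (chainPoint z 𝒜 n x) N ω ∧
      ¬ chainCount P z 𝒜 u B (n + 1) x < visits (chainPoint z 𝒜 (n + 1) x) N ω := by
    by_contra! hcon
    exact hend (Nat.rec h0 (fun n ih => hcon n ih) m)
  exact Set.mem_iUnion.2 ⟨n, Set.mem_iUnion₂.2 ⟨x, hx, N, hn, not_lt.1 hn'⟩⟩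

lemma chainLaw_biUnion_chainBreak_le (hH : ∀ w x, hitMean P w x ≠ ∞)
    (hR : ∀ x, returnMean P x ≠ ∞) (h𝒜 : IsAdmissible 𝒜) (hS0 : 0 ≤ S) (hSB : S < B) (hu : 0 < u)
    (hS : ∀ x ∈ A, ∑' n, chainTerm P 𝒜 n x ≤ ENNReal.ofReal S) (n : ℕ) (w : M) :
    chainLaw P w (⋃ x ∈ A, chainBreak P z 𝒜 u B n x) ≤
      chainCard (n + 1) * ENNReal.ofReal (Real.exp (1 - u ^ 2 / B ^ 2 * 2 ^ n)) := by
  obtain ⟨T, hTcard, hTA, hT⟩ := h𝒜.exists_representatives (n + 1)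
  have hsub : (⋃ x ∈ A, chainBreak P z 𝒜 u B n x) ⊆ ⋃ x ∈ T, chainBreak P z 𝒜 u B n x := by
    refine Set.iUnion₂_subset fun x hx => ?_
    obtain ⟨y, hy, hxy⟩ := hT x hx
    rw [h𝒜.chainBreak_congr hx (hTA y hy) hxy]
    exact Set.subset_biUnion_of_mem (u := fun x => chainBreak P z 𝒜 u B n x) hy
  calc _ ≤ ∑ x ∈ T, chainLaw P w (chainBreak P z 𝒜 u B n x) :=
        (measure_mono hsub).trans (measure_biUnion_finset_le _ _)
    _ ≤ T.card • ENNReal.ofReal (Real.exp (1 - u ^ 2 / B ^ 2 * 2 ^ n)) :=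
        Finset.sum_le_card_nsmul _ _ _ fun x hx =>
          chainLaw_chainBreak_le hH hR h𝒜 hS0 hSB hu (hTA x hx) (hS x (hTA x hx)) n w
    _ ≤ _ := by
        rw [nsmul_eq_mul]
        gcongr

lemma chainLaw_notCoveredAtVisit_le (hH : ∀ w x, hitMean P w x ≠ ∞)
    (hR : ∀ x, returnMean P x ≠ ∞) (h𝒜 : IsAdmissible 𝒜) (hz : z ∈ A) (hS0 : 0 ≤ S) (hSB : S < B)
    (hS : ∀ x ∈ A, ∑' n, chainTerm P 𝒜 n x ≤ ENNReal.ofReal S) (j : ℕ) :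
    chainLaw P z (notCoveredAtVisit z A j) ≤
      ENNReal.ofReal (17 * Real.exp (-(j * ((returnMean P z).toReal / B ^ 2)))) := by
  have hB : 0 < B := hS0.trans_lt hSB
  set t := j * ((returnMean P z).toReal / B ^ 2) with ht
  have ht0 : 0 ≤ t := by positivity
  -- Below the threshold of the union bound the claim is trivial, because `17 exp(-t) ≥ 1`.
  rcases lt_or_ge t (5 / 2) with h | h
  · refine prob_le_one.trans ?_
    rw [← ENNReal.ofReal_one]
    refine ENNReal.ofReal_le_ofReal ?_
    have h1 : Real.exp t ≤ 17 := (Real.exp_le_exp.2 h.le).trans exp_two_and_half_le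
    have h2 : Real.exp t * Real.exp (-t) = 1 := by rw [← Real.exp_add]; simp
    nlinarith [Real.exp_pos (-t)]
  · have htB : t * B ^ 2 = j * (returnMean P z).toReal := by rw [ht]; field_simp
    set u := √(j * (returnMean P z).toReal) with hu
    have husq : u ^ 2 = j * (returnMean P z).toReal := Real.sq_sqrt (by positivity)
    have hu0 : 0 < u := by
      refine Real.sqrt_pos.2 ?_
      rw [← htB]
      have : 0 < t := by linarith
      positivity
    have hut : u ^ 2 / B ^ 2 = t := by rw [husq, ht]; ring
    calc _ ≤ ∑' n, chainLaw P z (⋃ x ∈ A, chainBreak P z 𝒜 u B n x) :=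
          (measure_mono (notCoveredAtVisit_subset hH (hR z) h𝒜 hz hS0 hS husq)).trans
            (measure_iUnion_le _)
      _ ≤ ∑' n : ℕ, (chainCard (n + 1) : ℝ≥0∞) * ENNReal.ofReal (Real.exp (1 - t * 2 ^ n)) := by
          refine ENNReal.tsum_le_tsum fun n => ?_
          rw [← hut]
          exact chainLaw_biUnion_chainBreak_le hH hR h𝒜 hS0 hSB hu0 hS n z
      _ ≤ _ := tsum_chainCard_mul_exp_le h

/-- The chaining bound for the expected cover time. -/
lemma expectedCoverTime_le_chaining (hH : ∀ w x, hitMean P w x ≠ ∞)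
    (hR : ∀ x, returnMean P x ≠ ∞) (h𝒜 : IsAdmissible 𝒜) (hz : z ∈ A) :
    expectedCoverTime P z A ≤ 40 * (⨆ x ∈ A, ∑' n, chainTerm P 𝒜 n x) ^ 2 := by
  by_cases hA : A ⊆ {z}
  · rw [expectedCoverTime_eq_zero_of_subset P hA]
    exact zero_le
  obtain ⟨y, hy, hyz⟩ := Set.not_subset.1 hA
  have hzy : z ≠ y := fun h => hyz h.symm
  set V := ⨆ x ∈ A, ∑' n, chainTerm P 𝒜 n x with hV
  by_cases hVtop : V = ∞
  · simp [hVtop]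
  set S := V.toReal with hSdef
  have hVS : V = ENNReal.ofReal S := (ENNReal.ofReal_toReal hVtop).symm
  have hS (x : M) (hx : x ∈ A) : ∑' n, chainTerm P 𝒜 n x ≤ ENNReal.ofReal S :=
    hVS ▸ le_iSup₂_of_le x hx le_rfl
  have hS0 : 0 ≤ S := ENNReal.toReal_nonneg
  set R := (returnMean P z).toReal with hRdef
  have hR1 : 1 ≤ R := by
    simpa using ENNReal.toReal_mono (hR z) (one_le_returnMean P z)
  -- The partition at level 0 is trivial, so its term alone dominates `d(z, y)`, which bounds the
  -- mean return time.
  have hRS : R ≤ S ^ 2 := by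
    have h1 := le_chainTerm_toReal_sq (hS z hz) (n := 0) ((𝒜 0).mem_partOf hz)
      (h𝒜.partOf_zero_eq hz hy ▸ (𝒜 0).mem_partOf hy)
    have h2 : R ≤ (commuteDist P z y).toReal :=
      ENNReal.toReal_mono (ENNReal.add_ne_top.2 ⟨hH _ _, hH _ _⟩) (returnMean_le_commuteDist P hzy)
    have h3 : (chainTerm P 𝒜 0 z).toReal ≤ S :=
      ENNReal.toReal_le_of_le_ofReal hS0 ((ENNReal.le_tsum 0).trans (hS z hz))
    have h4 : (chainTerm P 𝒜 0 z).toReal ^ 2 ≤ S ^ 2 := by gcongr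
    linarith
  have hSpos : 0 < S := by
    rcases hS0.lt_or_eq with h | h
    · exact h
    · rw [← h] at hRS; norm_num at hRS; linarith
  -- Any `B > S` keeps the levels positive; `B = 11S/10` gives `17 (1 + 1.21) < 40`.
  have hB : 0 < (11 / 10 * S) := by positivity
  calc expectedCoverTime P z A
      ≤ returnMean P z * ∑' j, chainLaw P z (notCoveredAtVisit z A j) := expectedCoverTime_le P z A
    _ ≤ returnMean P z * ENNReal.ofReal (17 * (1 + 1 / (R / (11 / 10 * S) ^ 2))) := by
        gcongr
        exact (ENNReal.tsum_le_tsum fun j => chainLaw_notCoveredAtVisit_le hH hR h𝒜 hz hS0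
          (by linarith) hS j).trans (tsum_exp_le (by positivity))
    _ = ENNReal.ofReal (R * (17 * (1 + 1 / (R / (11 / 10 * S) ^ 2)))) := by
        rw [ENNReal.ofReal_mul (p := R) (by positivity), hRdef, ENNReal.ofReal_toReal (hR z)]
    _ ≤ ENNReal.ofReal (40 * S ^ 2) := by
        refine ENNReal.ofReal_le_ofReal ?_
        have : R * (17 * (1 + 1 / (R / (11 / 10 * S) ^ 2))) = 17 * (R + (11 / 10 * S) ^ 2) := by
          field_simp
        rw [this]
        nlinarith
    _ = 40 * V ^ 2 := by
        rw [hVS, ENNReal.ofReal_mul (by norm_num), ENNReal.ofReal_pow hS0]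
        norm_num

end Chaining

lemma diam_rpow {M : Type*} (d : M → M → ℝ≥0∞) (B : Set M) {r : ℝ} (hr : 0 < r) :
    diam (fun x y => d x y ^ r) B = diam d B ^ r := by
  simp only [diam, ← ENNReal.orderIsoRpow_apply r hr, OrderIso.map_iSup]

end CoverTime

/-! ### From a fixed admissible sequence to `γ₂`. -/

open CoverTime in
theorem mainTheorem1 {M : Type*} [Countable M] [MeasurableSpace M] [MeasurableSingletonClass M]
    (P : ProbabilityTheory.Kernel M M) [ProbabilityTheory.IsMarkovKernel P]
    (hirr : ProbabilityTheory.Kernel.IsIrreducible MeasureTheory.Measure.count P)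
    (hpos : CoverTime.PositiveRecurrent P) (A : Set M) :
    (∀ z ∈ A, ∀ 𝒜 : ℕ → Partition A, CoverTime.IsAdmissible 𝒜 →
      CoverTime.expectedCoverTime P z A ≤
        40 * (⨆ x ∈ A, ∑' n : ℕ, (2 : ℝ≥0∞) ^ ((n : ℝ) / 2) *
          (CoverTime.diam (CoverTime.commuteDist P) ((𝒜 n).partOf x)) ^ (1 / 2 : ℝ)) ^ 2) ∧
    CoverTime.cov P A ≤
      40 * (CoverTime.gamma2 A (fun x y => (CoverTime.commuteDist P x y) ^ (1 / 2 : ℝ))) ^ 2 := by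
  have hH (w x : M) : hitMean P w x ≠ ∞ := (hitMean_lt_top P hirr hpos w x).ne
  have hR (x : M) : returnMean P x ≠ ∞ := (hpos x).ne
  have main (z : M) (hz : z ∈ A) (𝒜 : ℕ → Partition A) (h𝒜 : IsAdmissible 𝒜) :=
    expectedCoverTime_le_chaining (P := P) hH hR h𝒜 hz
  refine ⟨main, iSup₂_le fun z hz => ?_⟩
  -- The constant and the square move to the left side, so that the infimum in `gamma2` stands alone
  -- and can be tested on each sequence.
  have h40 : (40 : ℝ≥0∞) ≠ 0 := by norm_num
  rw [mul_comm, ← ENNReal.div_le_iff_le_mul (Or.inl h40) (Or.inl (by norm_num))]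
  have hsq (a b : ℝ≥0∞) : a ≤ b ^ 2 ↔ a ^ (1 / 2 : ℝ) ≤ b := by
    rw [one_div, ENNReal.rpow_inv_le_iff (by norm_num)]
    norm_cast
  rw [hsq]
  refine le_iInf₂ fun 𝒜 h𝒜 => ?_
  rw [← hsq]
  simp only [diam_rpow _ _ (show (0 : ℝ) < 1 / 2 by norm_num)]
  exact ENNReal.div_le_of_le_mul' (main z hz 𝒜 h𝒜)
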